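/- Call a group icc if it is nontrivial and each of its nontrivial elements has an infinite conjugacy class. Let $X$ be a nonempty connected graph (possibly infinite, with loops and multiple edges allowed) and let $(\mathcal G,X)$ be a graph of groups on $X$: a group $G(s)$ for every vertex $s$ and, for every edge $e$ with (arbitrarily chosen) origin $s_0$ and terminus $s_1$, a group $G(e)$ with two monomorphisms $G(e)\to G(s_0)$, $a\mapsto a^{o}$, and $G(e)\to G(s_1)$, $a\mapsto a^{t}$. Let $F(\mathcal G,X)$ be the group generated by the groups $G(s)$ and one letter for every edge $e$ (also denoted by $e$), subject to the relations $e\,a^{t}e^{-1}=a^{o}$ for every edge $e$ and every $a\in G(e)$. For a vertex $x$, the fundamental group $\pi_1(\mathcal G,X)=\pi_1(\mathcal G,X,x)$ is the subgroup of $F(\mathcal G,X)$ of the elements $r_0e_1^{\varepsilon_1}r_1\cdots e_n^{\varepsilon_n}r_n$ ($n\ge 0$, $\varepsilon_i=\pm1$), where $e_1^{\varepsilon_1},\dots,e_n^{\varepsilon_n}$ is a closed edge path in $X$ based at $x$ and each $r_i$ lies in the group of the vertex of the path at which it is inserted. **Proposition (graphs of groups).** Suppose that every vertex group $G(s)$ is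 icc and that, for every edge $e$ with origin $s_0$ and terminus $s_1$ (possibly $s_0=s_1$), the image of $G(e)$ has index greater than $2$ (possibly infinite) in $G(s_0)$ or the image of $G(e)$ has index greater than $2$ in $G(s_1)$. Then, for every vertex $x$ of $X$, the group $\pi_1(\mathcal G,X,x)$ is icc. -/

import Mathlib

universe u v w w'

/-- A group is icc (infinite conjugacy classes) if it is nontrivial and every nontrivial element
has an infinite conjugacy class. -/
def IsICC (G : Type*) [Group G] : Prop :=
  Nontrivial G ∧ ∀ g : G, g ≠ 1 → (conjugatesOf g).Infinite

/-- A graph of groups on a graph with vertex set `V`. The graph is a multigraph (loops and multiple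
edges allowed) presented by an arbitrary orientation: the elements of `v ⟶ w` are the geometric
edges which, for the chosen orientation, have origin `v` and terminus `w`. In Serre's language the
oriented edges are the arrows `e` together with their formal inverses `e⁻¹`, and `edgeGroup e` is
the common group of `e` and `e⁻¹`, equipped with its two monomorphisms into the groups of its
end vertices. -/
structure GraphOfGroups (V : Type u) [Quiver.{v} V] where
  /-- the group of a vertex -/
  vertexGroup : V → Type w
  [vertexInst : ∀ x, Group (vertexGroup x)]
  /-- the group of an edge -/
  edgeGroup : ∀ {x y : V}, (x ⟶ y) → Type w'
  [edgeInst : ∀ {x y : V} (e : x ⟶ y), Group (edgeGroup e)]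
  /-- the embedding of an edge group in the group of the origin -/
  toOrigin : ∀ {x y : V} (e : x ⟶ y), edgeGroup e →* vertexGroup x
  /-- the embedding of an edge group in the group of the terminus -/
  toTerminus : ∀ {x y : V} (e : x ⟶ y), edgeGroup e →* vertexGroup y
  toOrigin_injective : ∀ {x y : V} (e : x ⟶ y), Function.Injective (toOrigin e)
  toTerminus_injective : ∀ {x y : V} (e : x ⟶ y), Function.Injective (toTerminus e)

namespace GraphOfGroups

attribute [instance] GraphOfGroups.vertexInst GraphOfGroups.edgeInst

variable {V : Type u} [Quiver.{v} V] (𝒢 : GraphOfGroups.{u, v, w, w'} V)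

/-- The free product of all the vertex groups and of the free group on the edges. -/
abbrev FreeProd : Type (max u v w) :=
  Monoid.Coprod (Monoid.CoprodI 𝒢.vertexGroup) (FreeGroup (Σ x y : V, (x ⟶ y)))

/-- A vertex group in the free product. -/
def preOf (x : V) : 𝒢.vertexGroup x →* 𝒢.FreeProd :=
  Monoid.Coprod.inl.comp (Monoid.CoprodI.of (M := 𝒢.vertexGroup) (i := x))

/-- The letter of an edge in the free product. -/
def preLetter {x y : V} (e : x ⟶ y) : 𝒢.FreeProd :=
  Monoid.Coprod.inr (FreeGroup.of ⟨x, y, e⟩)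

/-- The relators `e · a_terminus · e⁻¹ · (a_origin)⁻¹`, for `e` an edge and `a` in its group. -/
def relators : Set 𝒢.FreeProd :=
  {r | ∃ (x y : V) (e : x ⟶ y) (a : 𝒢.edgeGroup e),
    r = 𝒢.preLetter e * 𝒢.preOf y (𝒢.toTerminus e a) * (𝒢.preLetter e)⁻¹ *
      (𝒢.preOf x (𝒢.toOrigin e a))⁻¹}

/-- Serre's universal group `F(𝒢, X)`: it is generated by the vertex groups and one letter per
edge, subject to the relations `e · a_terminus · e⁻¹ = a_origin`. -/
abbrev PathGroup : Type (max u v w) :=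
  𝒢.FreeProd ⧸ Subgroup.normalClosure 𝒢.relators

/-- The canonical map from a vertex group to `F(𝒢, X)`. -/
def of (x : V) : 𝒢.vertexGroup x →* 𝒢.PathGroup :=
  (QuotientGroup.mk' (Subgroup.normalClosure 𝒢.relators)).comp (𝒢.preOf x)

/-- The element of `F(𝒢, X)` given by an edge. -/
def letter {x y : V} (e : x ⟶ y) : 𝒢.PathGroup :=
  QuotientGroup.mk' (Subgroup.normalClosure 𝒢.relators) (𝒢.preLetter e)

/-- `𝒢.IsPath x y p` says that `p ∈ F(𝒢, X)` is represented by a word `r₀ e₁ r₁ ⋯ eₙ rₙ` in which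
`e₁, …, eₙ` are the successive oriented edges (arrows or inverses of arrows) of an edge path from
`x` to `y`, and every `rᵢ` lies in the group of the vertex of this path where it is inserted. -/
inductive IsPath (x : V) : V → 𝒢.PathGroup → Prop
  | base (g : 𝒢.vertexGroup x) : IsPath x x (𝒢.of x g)
  | forward {y z : V} {p : 𝒢.PathGroup} (hp : IsPath x y p) (e : y ⟶ z) (g : 𝒢.vertexGroup z) :
      IsPath x z (p * 𝒢.letter e * 𝒢.of z g)
  | backward {y z : V} {p : 𝒢.PathGroup} (hp : IsPath x y p) (e : z ⟶ y) (g : 𝒢.vertexGroup z) :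
      IsPath x z (p * (𝒢.letter e)⁻¹ * 𝒢.of z g)

variable {𝒢}

theorem IsPath.mul_of {x y : V} {p : 𝒢.PathGroup} (hp : 𝒢.IsPath x y p) (g : 𝒢.vertexGroup y) :
    𝒢.IsPath x y (p * 𝒢.of y g) := by
  cases hp with
  | base h => rw [← map_mul]; exact .base _
  | forward hq e h => rw [mul_assoc, ← map_mul]; exact .forward hq e _
  | backward hq e h => rw [mul_assoc, ← map_mul]; exact .backward hq e _

theorem IsPath.mul {x y z : V} {p q : 𝒢.PathGroup} (hp : 𝒢.IsPath x y p) (hq : 𝒢.IsPath y z q) :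
    𝒢.IsPath x z (p * q) := by
  induction hq with
  | base g => exact hp.mul_of g
  | forward _ e g ih => rw [← mul_assoc, ← mul_assoc]; exact .forward ih e g
  | backward _ e g ih => rw [← mul_assoc, ← mul_assoc]; exact .backward ih e g

theorem IsPath.inv {x y : V} {p : 𝒢.PathGroup} (hp : 𝒢.IsPath x y p) : 𝒢.IsPath y x p⁻¹ := by
  induction hp with
  | base g => rw [← map_inv]; exact .base _
  | @forward y z p _ e g ih =>
    have h := ((IsPath.base (𝒢 := 𝒢) (g⁻¹)).backward e 1).mul ih
    simpa [mul_assoc] using h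
  | @backward y z p _ e g ih =>
    have h := ((IsPath.base (𝒢 := 𝒢) (g⁻¹)).forward e 1).mul ih
    simpa [mul_assoc] using h

variable (𝒢)

/-- The fundamental group `π₁(𝒢, X, x)` of a graph of groups at the vertex `x`: the subgroup of
`F(𝒢, X)` of the elements represented by loops at `x`. -/
def fundamentalGroup (x : V) : Subgroup 𝒢.PathGroup where
  carrier := {p | 𝒢.IsPath x x p}
  one_mem' := by simpa using IsPath.base (𝒢 := 𝒢) (x := x) 1
  mul_mem' hp hq := IsPath.mul hp hq
  inv_mem' hp := IsPath.inv hp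

end GraphOfGroups

/-! `F(𝒢, X)` is an HNN extension of the free product of the vertex groups with one stable letter
per edge. Van der Waerden's trick, an action on normal words, shows that the vertex groups embed and
that the number of letters of a reduced word depends only on the element it represents
(`Reduced.length_eq`).

A nontrivial loop is conjugate, up to a change of base point, to an element of a vertex group, where
icc applies, or to a cyclically reduced word `w` of length `n ≥ 1`. In the second case, rotating or
inverting `w` makes it begin with an oriented edge `u` whose subgroup `H` has index greater than 2
in the group of its source. Write `w = p g` with `g` the final vertex element. Some `d` in that
vertex group avoids both `H` and `H g`, so `w^{-(k+1)} d w d⁻¹ w^{k+1}` has a reduced form with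
`(2k+3)n` letters. These conjugates are pairwise distinct (`Reduced.infConj_of_branching`). -/

/-! ### Normal words for an HNN extension with several stable letters -/

namespace MultiHNN

variable {G ι : Type*} [Group G] {K : ι → Type*} [∀ i, Group (K i)]

/-- The opposite of a signed letter. -/
def bar (u : ι × Bool) : ι × Bool := (u.1, !u.2)

@[simp] theorem bar_bar (u : ι × Bool) : bar (bar u) = u := by simp [bar]

theorem bar_ne (u : ι × Bool) : u ≠ bar u := by
  rcases u with ⟨i, b⟩
  cases b <;> simp [bar]

variable (j : ∀ i, Bool → K i →* G)

/-- The associated subgroup to the left of a signed letter. -/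
def side (u : ι × Bool) : Subgroup G := (j u.1 u.2).range

open Classical in
/-- A representative of the right coset `H g`, equal to `1` for the coset `H`. -/
noncomputable def rep (H : Subgroup G) (g : G) : G :=
  if g ∈ H then 1 else (Quotient.mk (QuotientGroup.rightRel H) g).out

theorem rep_of_mem {H : Subgroup G} {g : G} (h : g ∈ H) : rep H g = 1 := if_pos h

theorem rep_mul {H : Subgroup G} {a : G} (ha : a ∈ H) (g : G) : rep H (a * g) = rep H g := by
  unfold rep
  rw [H.mul_mem_cancel_left ha]
  congr 2
  refine Quotient.sound ?_
  rw [← Quotient.eq_iff_equiv, Quotient.eq, QuotientGroup.rightRel_apply]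
  simpa using ha

theorem mul_rep_inv_mem (H : Subgroup G) (g : G) : g * (rep H g)⁻¹ ∈ H := by
  unfold rep
  split_ifs with h
  · simpa using h
  · rw [← QuotientGroup.rightRel_apply]
    exact Quotient.exact (Quotient.out_eq _)

theorem exists_coord (u : ι × Bool) (g : G) :
    ∃ a, j u.1 (bar u).2 a = g * (rep (side j (bar u)) g)⁻¹ :=
  mul_rep_inv_mem (side j (bar u)) g

/-- The subgroup component of `g` with respect to the chosen transversal to the right of `u`. -/
noncomputable def coord (u : ι × Bool) (g : G) : K u.1 := (exists_coord j u g).choose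

theorem coord_spec (u : ι × Bool) (g : G) :
    j u.1 (bar u).2 (coord j u g) * rep (side j (bar u)) g = g := by
  rw [coord, (exists_coord j u g).choose_spec, inv_mul_cancel_right]

theorem coord_eq (hj : ∀ i b, Function.Injective (j i b)) {u : ι × Bool} {g : G} {a : K u.1}
    (h : j u.1 (bar u).2 a * rep (side j (bar u)) g = g) : coord j u g = a :=
  hj _ _ (mul_right_cancel ((coord_spec j u g).trans h.symm))

/-- The letter `u` cancels against the word with head `g` and tail `l`. -/
def Cancels (u : ι × Bool) (g : G) (l : List ((ι × Bool) × G)) : Prop :=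
  ∃ r l', l = (bar u, r) :: l' ∧ g ∈ side j (bar u)

/-- The tails of normal words. -/
def Valid : List ((ι × Bool) × G) → Prop
  | [] => True
  | (u, r) :: l => rep (side j (bar u)) r = r ∧ ¬ Cancels j u r l ∧ Valid l

theorem cancels_mul {u : ι × Bool} {a : G} (ha : a ∈ side j (bar u)) {g : G}
    {l : List ((ι × Bool) × G)} : Cancels j u (a * g) l ↔ Cancels j u g l := by
  simp only [Cancels, Subgroup.mul_mem_cancel_left _ ha]

open Classical in
/-- Left multiplication of a word by a signed letter. -/
noncomputable def step (u : ι × Bool) (p : G × List ((ι × Bool) × G)) :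
    G × List ((ι × Bool) × G) :=
  -- The default `1` is never used: cancellation forces a nonempty tail.
  if Cancels j u p.1 p.2 then (j u.1 u.2 (coord j u p.1) * (p.2.map Prod.snd).headD 1, p.2.tail)
  else (j u.1 u.2 (coord j u p.1), (u, rep (side j (bar u)) p.1) :: p.2)

theorem step_of_mem {u : ι × Bool} {g : G} (hg : g ∈ side j (bar u)) (r : G)
    (l : List ((ι × Bool) × G)) :
    step j u (g, (bar u, r) :: l) = (j u.1 u.2 (coord j u g) * r, l) := by
  rw [step, if_pos ⟨r, l, rfl, hg⟩]
  rfl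

theorem step_of_not {u : ι × Bool} {g : G} {l : List ((ι × Bool) × G)} (h : ¬ Cancels j u g l) :
    step j u (g, l) = (j u.1 u.2 (coord j u g), (u, rep (side j (bar u)) g) :: l) := by
  rw [step, if_neg h]

theorem valid_step (u : ι × Bool) {p : G × List ((ι × Bool) × G)} (hp : Valid j p.2) :
    Valid j (step j u p).2 := by
  obtain ⟨g, l⟩ := p
  by_cases h : Cancels j u g l
  · obtain ⟨r, l, rfl, hg⟩ := h
    rw [step_of_mem j hg]
    exact hp.2.2
  · rw [step_of_not j h]
    have hs := coord_spec j u g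
    have hm : j u.1 (bar u).2 (coord j u g) ∈ side j (bar u) := ⟨_, rfl⟩
    refine ⟨?_, ?_, hp⟩
    · rw [← rep_mul hm, hs]
    · rwa [← cancels_mul j hm, hs]

variable {j}

/-- Removing and creating a letter undo each other. After a removal, validity forbids `bar u` to
cancel, so the letter returns with its old representative; after a creation, the new head lies in
`side j u`, so `bar u` cancels. -/
theorem step_bar_step (hj : ∀ i b, Function.Injective (j i b)) (u : ι × Bool)
    {p : G × List ((ι × Bool) × G)} (hp : Valid j p.2) : step j (bar u) (step j u p) = p := by
  obtain ⟨i, b⟩ := u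
  obtain ⟨g, l⟩ := p
  by_cases h : Cancels j (i, b) g l
  · obtain ⟨r, l, rfl, hg⟩ := h
    obtain ⟨hr, hc, -⟩ := hp
    rw [step_of_mem j hg]
    have hm : j i b (coord j (i, b) g) ∈ side j (bar (bar (i, b))) := by
      rw [bar_bar]; exact ⟨_, rfl⟩
    rw [step_of_not j (by rwa [cancels_mul j hm]), rep_mul hm, hr]
    have h1 : coord j (bar (i, b)) (j i b (coord j (i, b) g) * r) = coord j (i, b) g := by
      apply coord_eq j hj
      rw [rep_mul hm, hr]
      -- `!!b` reduces to `b` only for a literal `b`.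
      cases b <;> exact rfl
    have h2 := coord_spec j (i, b) g
    rw [rep_of_mem hg, mul_one] at h2
    dsimp only at h1 h2 ⊢
    rw [h1]
    exact congrArg (·, _) h2
  · rw [step_of_not j h]
    have hm : j i b (coord j (i, b) g) ∈ side j (bar (bar (i, b))) := by
      rw [bar_bar]; exact ⟨_, rfl⟩
    have h1 : coord j (bar (i, b)) (j i b (coord j (i, b) g)) = coord j (i, b) g := by
      apply coord_eq j hj
      rw [rep_of_mem hm]
      cases b <;> exact mul_one _
    have h3 := step_of_mem j hm (rep (side j (bar (i, b))) g) l
    rw [bar_bar] at h3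
    dsimp only at h1 h3 ⊢
    rw [h3, h1]
    exact congrArg (·, _) (coord_spec j (i, b) g)

/-- This is the HNN relation on normal words; through it the action respects the relators. -/
theorem step_mul (hj : ∀ i b, Function.Injective (j i b)) (u : ι × Bool) (a : K u.1) (g : G)
    (l : List ((ι × Bool) × G)) :
    step j u (j u.1 (bar u).2 a * g, l) =
      (j u.1 u.2 a * (step j u (g, l)).1, (step j u (g, l)).2) := by
  have hm : j u.1 (bar u).2 a ∈ side j (bar u) := ⟨_, rfl⟩
  have hc : coord j u (j u.1 (bar u).2 a * g) = a * coord j u g := by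
    apply coord_eq j hj
    rw [rep_mul hm, map_mul, mul_assoc, coord_spec]
  by_cases h : Cancels j u g l
  · obtain ⟨r, l, rfl, hg⟩ := h
    rw [step_of_mem j hg, step_of_mem j (mul_mem hm hg), hc, map_mul, mul_assoc]
  · rw [step_of_not j h, step_of_not j (by rwa [cancels_mul j hm]), hc, map_mul, rep_mul hm]

variable (j) in
/-- Normal words: a head in the base group and a valid tail. -/
def NormalWord : Type _ := {p : G × List ((ι × Bool) × G) // Valid j p.2}

/-- The base group acts on normal words by left multiplication on the head. -/
def baseHom : G →* Equiv.Perm (NormalWord j) where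
  toFun g :=
    { toFun := fun p => ⟨(g * p.1.1, p.1.2), p.2⟩
      invFun := fun p => ⟨(g⁻¹ * p.1.1, p.1.2), p.2⟩
      left_inv := fun p => Subtype.ext (by simp)
      right_inv := fun p => Subtype.ext (by simp) }
  map_one' := Equiv.ext fun p => Subtype.ext (Prod.ext (one_mul _) rfl)
  map_mul' g h := Equiv.ext fun p => Subtype.ext (Prod.ext (mul_assoc _ _ _) rfl)

theorem baseHom_apply (g : G) (p : NormalWord j) : (baseHom g p).1 = (g * p.1.1, p.1.2) := rfl

/-- The permutation of normal words given by a signed letter. -/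
noncomputable def letterPerm (hj : ∀ i b, Function.Injective (j i b)) (u : ι × Bool) :
    Equiv.Perm (NormalWord j) where
  toFun p := ⟨step j u p.1, valid_step j u p.2⟩
  invFun p := ⟨step j (bar u) p.1, valid_step j (bar u) p.2⟩
  left_inv p := Subtype.ext (step_bar_step hj u p.2)
  right_inv p := Subtype.ext (by
    have := step_bar_step hj (bar u) p.2
    rwa [bar_bar] at this)

theorem letterPerm_bar (hj : ∀ i b, Function.Injective (j i b)) (u : ι × Bool) :
    letterPerm hj (bar u) = (letterPerm hj u)⁻¹ :=
  Equiv.ext fun _ => rfl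

theorem letterPerm_mul_baseHom (hj : ∀ i b, Function.Injective (j i b)) (u : ι × Bool)
    (a : K u.1) :
    letterPerm hj u * baseHom (j u.1 (bar u).2 a) = baseHom (j u.1 u.2 a) * letterPerm hj u :=
  Equiv.ext fun p => Subtype.ext (step_mul hj u a p.1.1 p.1.2)

/-- The point is that the new head lies in `side j u`, so it cannot affect whether the next letter
cancels. -/
theorem letterPerm_apply_of_not (hj : ∀ i b, Function.Injective (j i b)) {u : ι × Bool}
    {p : NormalWord j} (hp : ¬ Cancels j u p.1.1 p.1.2) :
    ∃ a r, a ∈ side j u ∧ (letterPerm hj u p).1 = (a, (u, r) :: p.1.2) :=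
  ⟨_, _, ⟨_, rfl⟩, step_of_not j hp⟩

end MultiHNN

/-! ### Reduced words in the path group of a graph of groups -/

namespace GraphOfGroups

open MultiHNN

variable {V : Type u} [Quiver.{v} V] (𝒢 : GraphOfGroups.{u, v, w, w'} V)

/-- The free product of the vertex groups. -/
abbrev VertexProd : Type (max u w) := Monoid.CoprodI 𝒢.vertexGroup

/-- A vertex group as a subgroup of the free product of the vertex groups. -/
def vertexSubgroup (x : V) : Subgroup 𝒢.VertexProd :=
  (Monoid.CoprodI.of (M := 𝒢.vertexGroup) (i := x)).range

/-- The two embeddings of an edge group in the free product of the vertex groups, that of the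
origin being indexed by `true`. -/
def edgeHom (i : Σ x y : V, (x ⟶ y)) : Bool → 𝒢.edgeGroup i.2.2 →* 𝒢.VertexProd
  | true => (Monoid.CoprodI.of (M := 𝒢.vertexGroup)).comp (𝒢.toOrigin i.2.2)
  | false => (Monoid.CoprodI.of (M := 𝒢.vertexGroup)).comp (𝒢.toTerminus i.2.2)

theorem edgeHom_injective (i : Σ x y : V, (x ⟶ y)) (b : Bool) :
    Function.Injective (𝒢.edgeHom i b) := by
  cases b
  · exact (Monoid.CoprodI.of_injective _).comp (𝒢.toTerminus_injective i.2.2)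
  · exact (Monoid.CoprodI.of_injective _).comp (𝒢.toOrigin_injective i.2.2)

/-- The free product of the vertex groups maps to the path group. -/
def ofProd : 𝒢.VertexProd →* 𝒢.PathGroup :=
  (QuotientGroup.mk' (Subgroup.normalClosure 𝒢.relators)).comp Monoid.Coprod.inl

theorem ofProd_of (x : V) (g : 𝒢.vertexGroup x) :
    𝒢.ofProd (Monoid.CoprodI.of g) = 𝒢.of x g := rfl

/-- The element of the path group given by an oriented edge. -/
def dart (u : (Σ x y : V, (x ⟶ y)) × Bool) : 𝒢.PathGroup :=
  bif u.2 then 𝒢.letter u.1.2.2 else (𝒢.letter u.1.2.2)⁻¹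

@[simp] theorem dart_bar (u : (Σ x y : V, (x ⟶ y)) × Bool) : 𝒢.dart (bar u) = (𝒢.dart u)⁻¹ := by
  obtain ⟨i, b⟩ := u
  cases b <;> simp [dart, bar]

theorem letter_mul_of {x y : V} (e : x ⟶ y) (a : 𝒢.edgeGroup e) :
    𝒢.letter e * 𝒢.of y (𝒢.toTerminus e a) = 𝒢.of x (𝒢.toOrigin e a) * 𝒢.letter e := by
  rw [← mul_inv_eq_iff_eq_mul, ← mul_inv_eq_one]
  exact (QuotientGroup.eq_one_iff _).2 (Subgroup.subset_normalClosure ⟨x, y, e, a, rfl⟩)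

theorem dart_mul_ofProd (u : (Σ x y : V, (x ⟶ y)) × Bool) (a : 𝒢.edgeGroup u.1.2.2) :
    𝒢.dart u * 𝒢.ofProd (𝒢.edgeHom u.1 (bar u).2 a) =
      𝒢.ofProd (𝒢.edgeHom u.1 u.2 a) * 𝒢.dart u := by
  obtain ⟨i, b⟩ := u
  cases b
  · change (𝒢.letter i.2.2)⁻¹ * 𝒢.of i.1 (𝒢.toOrigin i.2.2 a) =
      𝒢.of i.2.1 (𝒢.toTerminus i.2.2 a) * (𝒢.letter i.2.2)⁻¹
    rw [inv_mul_eq_iff_eq_mul, ← mul_assoc, letter_mul_of, mul_inv_cancel_right]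
  · exact 𝒢.letter_mul_of i.2.2 a

/-- The action of the path group on normal words. -/
noncomputable def act : 𝒢.PathGroup →* Equiv.Perm (NormalWord 𝒢.edgeHom) :=
  QuotientGroup.lift (Subgroup.normalClosure 𝒢.relators)
    (Monoid.Coprod.lift baseHom
      (FreeGroup.lift fun i => letterPerm 𝒢.edgeHom_injective (i, true))) <| by
    refine Subgroup.normalClosure_le_normal (N := MonoidHom.ker _) ?_
    rintro _ ⟨x, y, e, a, rfl⟩
    rw [SetLike.mem_coe, MonoidHom.mem_ker, map_mul, map_inv, mul_inv_eq_one, map_mul, map_inv,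
      mul_inv_eq_iff_eq_mul, map_mul]
    simp only [preLetter, preOf, MonoidHom.comp_apply, Monoid.Coprod.lift_apply_inl,
      Monoid.Coprod.lift_apply_inr, FreeGroup.lift_apply_of]
    exact letterPerm_mul_baseHom 𝒢.edgeHom_injective (⟨x, y, e⟩, true) a

theorem act_ofProd (g : 𝒢.VertexProd) : 𝒢.act (𝒢.ofProd g) = baseHom g :=
  (QuotientGroup.lift_mk' _ _ _).trans (Monoid.Coprod.lift_apply_inl _ _ _)

theorem act_dart (u : (Σ x y : V, (x ⟶ y)) × Bool) :
    𝒢.act (𝒢.dart u) = letterPerm 𝒢.edgeHom_injective u := by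
  have h (i) : 𝒢.act (𝒢.letter i.2.2) = letterPerm 𝒢.edgeHom_injective (i, true) := by
    refine (QuotientGroup.lift_mk' _ _ _).trans ((Monoid.Coprod.lift_apply_inr _ _ _).trans ?_)
    simp
  obtain ⟨i, b⟩ := u
  cases b
  · simp only [dart, cond_false, map_inv, h]
    exact (letterPerm_bar _ _).symm
  · exact h i

/-- The vertex from which an oriented edge departs. -/
def src (u : (Σ x y : V, (x ⟶ y)) × Bool) : V := bif u.2 then u.1.1 else u.1.2.1

/-- `𝒢.Reduced u p n v` says that `p` is a reduced path word of length `n ≥ 1` beginning with the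
oriented edge `u` and ending with the oriented edge `v`. -/
inductive Reduced (u : (Σ x y : V, (x ⟶ y)) × Bool) :
    𝒢.PathGroup → ℕ → (Σ x y : V, (x ⟶ y)) × Bool → Prop
  | single : Reduced u (𝒢.dart u) 1 u
  | snoc {p : 𝒢.PathGroup} {n : ℕ} {v : (Σ x y : V, (x ⟶ y)) × Bool} (hp : Reduced u p n v)
      {g : 𝒢.VertexProd} (hg : g ∈ 𝒢.vertexSubgroup (src (bar v)))
      {w : (Σ x y : V, (x ⟶ y)) × Bool} (hw : src w = src (bar v))
      (h : ¬ (w = bar v ∧ g ∈ side 𝒢.edgeHom w)) :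
      Reduced u (p * 𝒢.ofProd g * 𝒢.dart w) (n + 1) w

variable {𝒢}

theorem Reduced.pos {u v : (Σ x y : V, (x ⟶ y)) × Bool} {p : 𝒢.PathGroup} {n : ℕ}
    (hp : 𝒢.Reduced u p n v) : 0 < n := by
  cases hp <;> omega

theorem Reduced.append {u v u' v' : (Σ x y : V, (x ⟶ y)) × Bool} {p q : 𝒢.PathGroup} {m n : ℕ}
    (hp : 𝒢.Reduced u p m v) {g : 𝒢.VertexProd} (hg : g ∈ 𝒢.vertexSubgroup (src (bar v)))
    (hw : src u' = src (bar v)) (h : ¬ (u' = bar v ∧ g ∈ side 𝒢.edgeHom u'))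
    (hq : 𝒢.Reduced u' q n v') : 𝒢.Reduced u (p * 𝒢.ofProd g * q) (m + n) v' := by
  induction hq with
  | single => exact hp.snoc hg hw h
  | snoc _ hg' hw' h' ih => simpa only [mul_assoc, add_assoc] using ih.snoc hg' hw' h'

theorem Reduced.inv {u v : (Σ x y : V, (x ⟶ y)) × Bool} {p : 𝒢.PathGroup} {n : ℕ}
    (hp : 𝒢.Reduced u p n v) : 𝒢.Reduced (bar v) p⁻¹ n (bar u) := by
  induction hp with
  | single => rw [← dart_bar]; exact .single
  | @snoc p n v _ g hg w hw h ih =>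
    have h1 := (Reduced.single (𝒢 := 𝒢) (u := bar w)).append (g := g⁻¹) (u' := bar v)
      (by rw [bar_bar, hw]; exact inv_mem hg) (by rw [bar_bar, hw])
      (by
        rw [bar_bar, inv_mem_iff]
        rintro ⟨rfl, h2⟩
        exact h ⟨rfl, h2⟩) ih
    simpa [mul_assoc, add_comm] using h1

theorem Reduced.isPath {u v : (Σ x y : V, (x ⟶ y)) × Bool} {p : 𝒢.PathGroup} {n : ℕ}
    (hp : 𝒢.Reduced u p n v) : 𝒢.IsPath (src u) (src (bar v)) p := by
  have key (w : (Σ x y : V, (x ⟶ y)) × Bool) : 𝒢.IsPath (src w) (src (bar w)) (𝒢.dart w) := by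
    obtain ⟨i, b⟩ := w
    cases b
    · change 𝒢.IsPath i.2.1 i.1 (𝒢.letter i.2.2)⁻¹
      simpa using (IsPath.base (𝒢 := 𝒢) (x := i.2.1) 1).backward i.2.2 1
    · change 𝒢.IsPath i.1 i.2.1 (𝒢.letter i.2.2)
      simpa using (IsPath.base (𝒢 := 𝒢) (x := i.1) 1).forward i.2.2 1
  induction hp with
  | single => exact key u
  | @snoc p n v _ g hg w hw h ih =>
    obtain ⟨g, rfl⟩ := hg
    exact (ih.mul_of g).mul (hw ▸ key w)

/-- Letters act from right to left. The head left by `w` lies in `side w`, so cancellation of the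
preceding `v` would need `w = bar v` and `g ∈ side w`, which reducedness excludes. -/
theorem Reduced.length_act {u v : (Σ x y : V, (x ⟶ y)) × Bool} {p : 𝒢.PathGroup} {n : ℕ}
    (hp : 𝒢.Reduced u p n v) {z : NormalWord 𝒢.edgeHom}
    (hz : ¬ Cancels 𝒢.edgeHom v z.1.1 z.1.2) :
    (𝒢.act p z).1.2.length = z.1.2.length + n := by
  induction hp generalizing z with
  | single =>
    obtain ⟨a, r, -, h⟩ := letterPerm_apply_of_not 𝒢.edgeHom_injective hz
    rw [act_dart, h, List.length_cons]
  | @snoc p n v _ g hg w hw h ih =>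
    obtain ⟨a, r, ha, h1⟩ := letterPerm_apply_of_not 𝒢.edgeHom_injective hz
    have h2 := baseHom_apply g (letterPerm 𝒢.edgeHom_injective w z)
    rw [h1] at h2
    rw [map_mul, map_mul, act_dart, act_ofProd, Equiv.Perm.mul_apply, Equiv.Perm.mul_apply, ih, h2]
    · simp only [List.length_cons]; omega
    · rw [h2]
      rintro ⟨r', l', h3, h4⟩
      obtain rfl : w = bar v := by simp_all
      exact h ⟨rfl, ((side 𝒢.edgeHom (bar v)).mul_mem_cancel_right ha).1 h4⟩

/-- The word without letters. -/
def emptyWord : NormalWord 𝒢.edgeHom := ⟨(1, []), trivial⟩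

theorem Reduced.length_eq {u v : (Σ x y : V, (x ⟶ y)) × Bool} {p : 𝒢.PathGroup} {n : ℕ}
    (hp : 𝒢.Reduced u p n v) (a b : 𝒢.VertexProd) :
    (𝒢.act (𝒢.ofProd a * p * 𝒢.ofProd b) emptyWord).1.2.length = n := by
  rw [map_mul, map_mul, act_ofProd, act_ofProd, Equiv.Perm.mul_apply, Equiv.Perm.mul_apply,
    baseHom_apply, hp.length_act]
  · exact zero_add n
  · rintro ⟨r, l, h, -⟩
    cases h

theorem of_injective (x : V) : Function.Injective (𝒢.of x) := by
  intro g h hgh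
  have := congrArg (fun p => (𝒢.act p emptyWord).1.1) hgh
  simp only [← ofProd_of, act_ofProd] at this
  exact Monoid.CoprodI.of_injective x (mul_right_cancel this)

end GraphOfGroups

/-! ### Conjugacy classes in the fundamental group -/

namespace GraphOfGroups

open MultiHNN

variable {V : Type u} [Quiver.{v} V] {𝒢 : GraphOfGroups.{u, v, w, w'} V}

theorem side_le (u : (Σ x y : V, (x ⟶ y)) × Bool) :
    side 𝒢.edgeHom u ≤ 𝒢.vertexSubgroup (src u) := by
  obtain ⟨i, b⟩ := u
  rintro _ ⟨a, rfl⟩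
  cases b
  · exact ⟨𝒢.toTerminus i.2.2 a, rfl⟩
  · exact ⟨𝒢.toOrigin i.2.2 a, rfl⟩

theorem isPath_ofProd {x : V} {g : 𝒢.VertexProd} (hg : g ∈ 𝒢.vertexSubgroup x) :
    𝒢.IsPath x x (𝒢.ofProd g) := by
  obtain ⟨g, rfl⟩ := hg
  exact .base g

variable (𝒢) in
/-- The element `p` has infinitely many conjugates under the loops at `x`. -/
def InfConj (x : V) (p : 𝒢.PathGroup) : Prop :=
  {q | ∃ c, 𝒢.IsPath x x c ∧ q = c * p * c⁻¹}.Infinite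

theorem InfConj.inv {x : V} {p : 𝒢.PathGroup} (h : 𝒢.InfConj x p) : 𝒢.InfConj x p⁻¹ := by
  refine (Set.Infinite.image (f := fun q => q⁻¹) inv_injective.injOn h).mono ?_
  rintro _ ⟨_, ⟨c, hc, rfl⟩, rfl⟩
  exact ⟨c, hc, by simp [mul_assoc]⟩

/-- This allows the base point to move during cyclic reduction and rotation. -/
theorem InfConj.conj {x y : V} {p c : 𝒢.PathGroup} (h : 𝒢.InfConj y p) (hc : 𝒢.IsPath x y c) :
    𝒢.InfConj x (c * p * c⁻¹) := by
  refine (Set.Infinite.image (f := fun q => c * q * c⁻¹) ?_ h).mono ?_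
  · exact (MulAut.conj c).injective.injOn
  · rintro _ ⟨_, ⟨d, hd, rfl⟩, rfl⟩
    exact ⟨c * d * c⁻¹, (hc.mul hd).mul hc.inv, by group⟩

theorem infConj_of {x : V} (hx : IsICC (𝒢.vertexGroup x)) {g : 𝒢.vertexGroup x} (hg : g ≠ 1) :
    𝒢.InfConj x (𝒢.of x g) := by
  refine (Set.Infinite.image (f := 𝒢.of x) (of_injective x).injOn (hx.2 g hg)).mono ?_
  rintro _ ⟨q, hq, rfl⟩
  obtain ⟨c, rfl⟩ := isConj_iff.1 hq
  exact ⟨𝒢.of x c, .base c, by simp⟩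

variable (𝒢) in
/-- The edge group of `u` is a large subgroup of the group of the vertex from which `u` departs:
two of its cosets never cover this group. -/
def Branching (u : (Σ x y : V, (x ⟶ y)) × Bool) : Prop :=
  ∀ g : 𝒢.VertexProd, ∃ h ∈ 𝒢.vertexSubgroup (src u),
    h ∉ side 𝒢.edgeHom u ∧ g * h⁻¹ ∉ side 𝒢.edgeHom u

theorem exists_ne_ne_of_two_lt_card {α : Type*} (h : 2 < ENat.card α) (a b : α) :
    ∃ c, c ≠ a ∧ c ≠ b := by
  by_contra! hc
  have : (Set.univ : Set α) ⊆ {a, b} := fun c _ => by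
    by_cases hca : c = a
    · exact .inl hca
    · exact .inr (hc c hca)
  have h2 := (Set.encard_le_encard this).trans (Set.encard_insert_le {b} a)
  rw [Set.encard_univ, Set.encard_singleton, one_add_one_eq_two] at h2
  exact absurd h h2.not_gt

theorem exists_notMem_range {G H K : Type*} [Group G] [Group H] [Group K] (f : G →* H)
    (hf : Function.Injective f) (k : K →* G) (hk : 2 < ENat.card (G ⧸ k.range)) (g : H) :
    ∃ h ∈ f.range, h ∉ (f.comp k).range ∧ g * h⁻¹ ∉ (f.comp k).range := by
  have hmem (a : G) : f a ∈ (f.comp k).range ↔ a ∈ k.range := by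
    rw [MonoidHom.range_comp, Subgroup.mem_map_iff_mem hf]
  have aux (a : G) : ∃ h : G, h ∉ k.range ∧ a * h⁻¹ ∉ k.range := by
    -- The quotient consists of left cosets, whereas right cosets are to be avoided; inversion
    -- exchanges them, hence `a⁻¹` here and the witness `c⁻¹` below.
    obtain ⟨c, h1, h2⟩ := exists_ne_ne_of_two_lt_card hk (1 : G) (a⁻¹ : G)
    obtain ⟨c, rfl⟩ := QuotientGroup.mk_surjective c
    refine ⟨c⁻¹, fun h => h1 ?_, fun h => h2 ?_⟩
    · exact (QuotientGroup.eq.2 (by simpa using h)).symm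
    · exact (QuotientGroup.eq.2 (by simpa using h)).symm
  by_cases hg : g ∈ f.range
  · obtain ⟨a, rfl⟩ := hg
    obtain ⟨h, h1, h2⟩ := aux a
    refine ⟨f h, ⟨h, rfl⟩, by rwa [hmem], by rwa [← map_inv, ← map_mul, hmem]⟩
  -- For `g` outside the factor, the second condition is automatic.
  · obtain ⟨h, h1, -⟩ := aux 1
    refine ⟨f h, ⟨h, rfl⟩, by rwa [hmem], fun h2 => hg ?_⟩
    have h3 : g * (f h)⁻¹ ∈ f.range := by
      obtain ⟨a, ha⟩ := h2
      exact ⟨k a, ha⟩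
    exact (f.range.mul_mem_cancel_right (inv_mem ⟨h, rfl⟩)).1 h3

theorem branching_or
    (hedge : ∀ (x y : V) (e : x ⟶ y),
      2 < ENat.card (𝒢.vertexGroup x ⧸ (𝒢.toOrigin e).range) ∨
      2 < ENat.card (𝒢.vertexGroup y ⧸ (𝒢.toTerminus e).range))
    (u : (Σ x y : V, (x ⟶ y)) × Bool) : 𝒢.Branching u ∨ 𝒢.Branching (bar u) := by
  have h (i : Σ x y : V, (x ⟶ y)) : 𝒢.Branching (i, true) ∨ 𝒢.Branching (i, false) :=
    (hedge i.1 i.2.1 i.2.2).imp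
      (exists_notMem_range _ (Monoid.CoprodI.of_injective i.1) (𝒢.toOrigin i.2.2))
      (exists_notMem_range _ (Monoid.CoprodI.of_injective i.2.1) (𝒢.toTerminus i.2.2))
  obtain ⟨i, b⟩ := u
  cases b
  · exact (h i).symm
  · exact h i

/-! ### Cyclically reduced words -/

theorem Reduced.pow {u v : (Σ x y : V, (x ⟶ y)) × Bool} {p : 𝒢.PathGroup} {n : ℕ}
    (hp : 𝒢.Reduced u p n v) (hu : src u = src (bar v)) {g : 𝒢.VertexProd}
    (hg : g ∈ 𝒢.vertexSubgroup (src (bar v))) (h : ¬ (u = bar v ∧ g ∈ side 𝒢.edgeHom u)) (k : ℕ) :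
    𝒢.Reduced u ((p * 𝒢.ofProd g) ^ k * p) ((k + 1) * n) v := by
  induction k with
  | zero => simpa using hp
  | succ k ih =>
    have := hp.append hg hu h ih
    rw [pow_succ', mul_assoc]
    convert this using 1
    ring

theorem Reduced.infConj_of_branching {u v : (Σ x y : V, (x ⟶ y)) × Bool} {p : 𝒢.PathGroup} {n : ℕ}
    (hp : 𝒢.Reduced u p n v) (hu : src u = src (bar v)) {g : 𝒢.VertexProd}
    (hg : g ∈ 𝒢.vertexSubgroup (src (bar v))) (h : ¬ (u = bar v ∧ g ∈ side 𝒢.edgeHom u))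
    (hbr : 𝒢.Branching u) : 𝒢.InfConj (src u) (p * 𝒢.ofProd g) := by
  obtain ⟨d, hd, hd1, hd2⟩ := hbr g
  have hpath : 𝒢.IsPath (src u) (src u) (p * 𝒢.ofProd g) := by
    have := hp.isPath.mul (isPath_ofProd hg)
    rwa [← hu] at this
  have hpow (k : ℕ) : 𝒢.IsPath (src u) (src u) ((p * 𝒢.ofProd g) ^ k) :=
    pow_mem (S := 𝒢.fundamentalGroup (src u)) hpath k
  let W (k : ℕ) : 𝒢.PathGroup :=
    (((p * 𝒢.ofProd g) ^ (k + 1))⁻¹ * 𝒢.ofProd d) * (p * 𝒢.ofProd g) *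
      (((p * 𝒢.ofProd g) ^ (k + 1))⁻¹ * 𝒢.ofProd d)⁻¹
  have hW (k : ℕ) : (𝒢.act (W k) emptyWord).1.2.length = (2 * k + 3) * n := by
    -- The middle `p` meets its neighbours around `d` and `g * d⁻¹`, where `hd1` and `hd2` prevent
    -- cancellation; the outer `g⁻¹` and `g` do not affect the length.
    have h1 := hp.pow hu hg h k
    have h2 := ((h1.inv.append (by rwa [bar_bar]) (by rw [bar_bar])
      (fun h' => hd1 h'.2) hp).append
        (mul_mem hg (inv_mem (hu ▸ hd))) hu (fun h' => hd2 h'.2) h1).length_eq g⁻¹ g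
    rw [show (2 * k + 3) * n = (k + 1) * n + n + (k + 1) * n by ring, ← h2]
    congr 4
    simp only [W, pow_succ, map_inv, map_mul]
    group
  refine Set.infinite_of_injective_forall_mem (f := W) (fun k l hkl => ?_) fun k =>
    ⟨_, (hpow (k + 1)).inv.mul (isPath_ofProd hd), rfl⟩
  have h1 := hW k
  rw [hkl, hW l] at h1
  have := Nat.eq_of_mul_eq_mul_right hp.pos h1
  omega

/-- Either end of `v` may be the large one. If it is the source, rotation brings the last letter `v`
to the front; otherwise the inverse word, which begins with `bar v`, is used. -/
theorem Reduced.infConj {u v : (Σ x y : V, (x ⟶ y)) × Bool} {p : 𝒢.PathGroup} {n : ℕ}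
    (hp : 𝒢.Reduced u p n v) (hu : src u = src (bar v)) {g : 𝒢.VertexProd}
    (hg : g ∈ 𝒢.vertexSubgroup (src (bar v))) (h : ¬ (u = bar v ∧ g ∈ side 𝒢.edgeHom u))
    (hbr : 𝒢.Branching v ∨ 𝒢.Branching (bar v)) : 𝒢.InfConj (src u) (p * 𝒢.ofProd g) := by
  rcases hbr with hbr | hbr
  · cases hp with
    | single => exact Reduced.single.infConj_of_branching hu hg h hbr
    | @snoc p n v' hp c hc _ hw h' =>
      have h1 := (Reduced.single.append hg hu h hp).infConj_of_branching hw hc h' hbr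
      convert h1.conj (hw ▸ hp.isPath.mul (isPath_ofProd hc)) using 1
      group
  · have h1 := hp.inv.infConj_of_branching (g := g⁻¹) (by rw [bar_bar, hu])
      (by rw [bar_bar, hu]; exact inv_mem hg)
      (by
        rw [bar_bar, inv_mem_iff]
        rintro ⟨rfl, h2⟩
        exact h ⟨rfl, h2⟩) hbr
    rw [← hu] at h1 hg
    convert (h1.conj (isPath_ofProd (inv_mem hg))).inv using 1
    simp only [map_inv]
    group

variable (𝒢) in
/-- `p` is given by a reduced path word of length `n` from `x` to `y`. -/
def HasForm (x y : V) (p : 𝒢.PathGroup) (n : ℕ) : Prop :=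
  (n = 0 ∧ x = y ∧ ∃ a ∈ 𝒢.vertexSubgroup x, p = 𝒢.ofProd a) ∨
  ∃ u q v, 𝒢.Reduced u q n v ∧ src u = x ∧ src (bar v) = y ∧
    ∃ a ∈ 𝒢.vertexSubgroup x, ∃ b ∈ 𝒢.vertexSubgroup y, p = 𝒢.ofProd a * q * 𝒢.ofProd b

theorem HasForm.mul_left {x y : V} {p : 𝒢.PathGroup} {n : ℕ} (hp : 𝒢.HasForm x y p n)
    {c : 𝒢.VertexProd} (hc : c ∈ 𝒢.vertexSubgroup x) : 𝒢.HasForm x y (𝒢.ofProd c * p) n := by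
  rcases hp with ⟨hn, hxy, a, ha, rfl⟩ | ⟨u, q, v, hq, hu, hv, a, ha, b, hb, rfl⟩
  · exact .inl ⟨hn, hxy, c * a, mul_mem hc ha, (map_mul _ _ _).symm⟩
  · exact .inr ⟨u, q, v, hq, hu, hv, c * a, mul_mem hc ha, b, hb, by simp only [map_mul, mul_assoc]⟩

theorem HasForm.mul_right {x y : V} {p : 𝒢.PathGroup} {n : ℕ} (hp : 𝒢.HasForm x y p n)
    {c : 𝒢.VertexProd} (hc : c ∈ 𝒢.vertexSubgroup y) : 𝒢.HasForm x y (p * 𝒢.ofProd c) n := by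
  rcases hp with ⟨hn, rfl, a, ha, rfl⟩ | ⟨u, q, v, hq, hu, hv, a, ha, b, hb, rfl⟩
  · exact .inl ⟨hn, rfl, a * c, mul_mem ha hc, (map_mul _ _ _).symm⟩
  · exact .inr ⟨u, q, v, hq, hu, hv, a, ha, b * c, mul_mem hb hc, by simp only [map_mul, mul_assoc]⟩

theorem Reduced.hasForm {u v : (Σ x y : V, (x ⟶ y)) × Bool} {p : 𝒢.PathGroup} {n : ℕ}
    (hp : 𝒢.Reduced u p n v) : 𝒢.HasForm (src u) (src (bar v)) p n :=
  .inr ⟨u, p, v, hp, rfl, rfl, 1, one_mem _, 1, one_mem _, by simp⟩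

/-- The edge relation turns `v g v⁻¹` into an element of the group at the source of `v`, which the
preceding vertex element absorbs. -/
theorem Reduced.hasForm_cancel {u v : (Σ x y : V, (x ⟶ y)) × Bool} {p : 𝒢.PathGroup} {n : ℕ}
    (hp : 𝒢.Reduced u p n v) {g : 𝒢.VertexProd} (hg : g ∈ side 𝒢.edgeHom (bar v)) :
    𝒢.HasForm (src u) (src v) (p * 𝒢.ofProd g * 𝒢.dart (bar v)) (n - 1) := by
  have key : ∃ b ∈ 𝒢.vertexSubgroup (src v),
      𝒢.dart v * 𝒢.ofProd g * 𝒢.dart (bar v) = 𝒢.ofProd b := by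
    obtain ⟨a, rfl⟩ := hg
    refine ⟨_, side_le v ⟨a, rfl⟩, ?_⟩
    rw [dart_bar, mul_inv_eq_iff_eq_mul]
    exact 𝒢.dart_mul_ofProd v a
  obtain ⟨b, hb, hgb⟩ := key
  cases hp with
  | single => exact .inl ⟨rfl, rfl, b, hb, hgb⟩
  | @snoc p n v' hp c hc _ hw h =>
    have := (hp.hasForm.mul_right hc).mul_right (hw ▸ hb)
    rw [hw, Nat.add_sub_cancel]
    simpa only [← hgb, mul_assoc] using this

theorem HasForm.mul_dart {x : V} {p : 𝒢.PathGroup} {n : ℕ} {w : (Σ x y : V, (x ⟶ y)) × Bool}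
    (hp : 𝒢.HasForm x (src w) p n) : ∃ m, 𝒢.HasForm x (src (bar w)) (p * 𝒢.dart w) m := by
  rcases hp with ⟨-, rfl, a, ha, rfl⟩ | ⟨u, q, v, hq, rfl, hv, a, ha, b, hb, rfl⟩
  · exact ⟨_, Reduced.single.hasForm.mul_left ha⟩
  · by_cases h : w = bar v ∧ b ∈ side 𝒢.edgeHom w
    · obtain ⟨rfl, h⟩ := h
      have := (hq.hasForm_cancel h).mul_left ha
      rw [bar_bar]
      exact ⟨_, by simpa only [mul_assoc] using this⟩
    · have := (hq.snoc (hv ▸ hb) hv.symm h).hasForm.mul_left ha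
      exact ⟨_, by simpa only [mul_assoc] using this⟩

theorem IsPath.exists_hasForm {x y : V} {p : 𝒢.PathGroup} (hp : 𝒢.IsPath x y p) :
    ∃ n, 𝒢.HasForm x y p n := by
  induction hp with
  | base g => exact ⟨0, .inl ⟨rfl, rfl, _, ⟨g, rfl⟩, rfl⟩⟩
  | @forward y z p _ e g ih =>
    obtain ⟨n, hn⟩ := ih
    obtain ⟨m, hm⟩ := hn.mul_dart (w := (⟨y, z, e⟩, true))
    exact ⟨m, hm.mul_right ⟨g, rfl⟩⟩
  | @backward y z p _ e g ih =>
    obtain ⟨n, hn⟩ := ih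
    obtain ⟨m, hm⟩ := hn.mul_dart (w := (⟨z, y, e⟩, false))
    exact ⟨m, hm.mul_right ⟨g, rfl⟩⟩

/-- Reduced words grow on the right, while cyclic reduction must also remove the first letter. -/
theorem Reduced.uncons {u v : (Σ x y : V, (x ⟶ y)) × Bool} {p : 𝒢.PathGroup} {n : ℕ}
    (hp : 𝒢.Reduced u p n v) : (u = v ∧ n = 1 ∧ p = 𝒢.dart u) ∨
      ∃ u' q m, 𝒢.Reduced u' q m v ∧ n = m + 1 ∧ src u' = src (bar u) ∧
        ∃ c ∈ 𝒢.vertexSubgroup (src (bar u)), p = 𝒢.dart u * 𝒢.ofProd c * q := by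
  induction hp with
  | single => exact .inl ⟨rfl, rfl, rfl⟩
  | @snoc p n v _ g hg w hw h ih =>
    right
    rcases ih with ⟨rfl, rfl, rfl⟩ | ⟨u', q, m, hq, rfl, hu', c, hc, rfl⟩
    · exact ⟨w, _, 1, .single, rfl, hw, g, hg, rfl⟩
    · exact ⟨u', _, _, hq.snoc hg hw h, rfl, hu', c, hc, by simp only [mul_assoc]⟩

/-- Cyclic reduction, by strong induction on the length: if the last and first letters cancel around
`b * a`, conjugation by the first letter gives a shorter loop at the neighbouring vertex. -/
theorem HasForm.infConj (hvertex : ∀ x : V, IsICC (𝒢.vertexGroup x))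
    (hbr : ∀ u, 𝒢.Branching u ∨ 𝒢.Branching (bar u)) {n : ℕ} {x : V} {p : 𝒢.PathGroup}
    (hp : 𝒢.HasForm x x p n) (hp1 : p ≠ 1) : 𝒢.InfConj x p := by
  induction n using Nat.strong_induction_on generalizing x p with
  | _ n ih =>
  rcases hp with ⟨-, -, _, ⟨a, rfl⟩, rfl⟩ | ⟨u, q, v, hq, rfl, hv, a, ha, b, hb, rfl⟩
  · exact infConj_of (hvertex x) fun ha => hp1 (by rw [ha]; simp)
  suffices 𝒢.InfConj (src u) (q * 𝒢.ofProd (b * a)) by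
    convert this.conj (isPath_ofProd ha) using 1
    simp only [map_mul]
    group
  have hba : b * a ∈ 𝒢.vertexSubgroup (src u) := mul_mem hb ha
  by_cases h : u = bar v ∧ b * a ∈ side 𝒢.edgeHom u
  · obtain ⟨rfl, h⟩ := h
    rcases hq.uncons with ⟨h1, -⟩ | ⟨u', q', m, hq', rfl, hu', c, hc, rfl⟩
    -- A single letter never cancels against itself cyclically, even for a loop edge.
    · exact absurd h1.symm (bar_ne v)
    · rw [bar_bar] at hu' hc
      -- Both end letters disappear: the length drops from `m + 1` to `m - 1`.
      have h1 := (hq'.hasForm_cancel h).mul_left (hu' ▸ hc)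
      rw [hu'] at h1
      have h2 := ih _ (by omega) h1 fun h2 => hp1 ?_
      · have h3 := h2.conj (x := src (bar v))
          (by simpa using (Reduced.single (𝒢 := 𝒢) (u := bar v)).isPath)
        convert h3 using 1
        rw [dart_bar]
        group
      · calc
          _ = 𝒢.ofProd a * 𝒢.dart (bar v) *
              (𝒢.ofProd c * (q' * 𝒢.ofProd (b * a) * 𝒢.dart (bar v))) *
              (𝒢.ofProd a * 𝒢.dart (bar v))⁻¹ := by rw [map_mul]; group
          _ = 1 := by rw [h2, mul_one, mul_inv_cancel]
  · exact hq.infConj hv.symm (hv.symm ▸ hba) h (hbr v)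

end GraphOfGroups

open GraphOfGroups in
theorem mainTheorem8 {V : Type u} [Quiver.{v} V]
    (hX : Quiver.IsStronglyConnected (Quiver.Symmetrify V))
    (𝒢 : GraphOfGroups.{u, v, w, w'} V)
    (hvertex : ∀ x : V, IsICC (𝒢.vertexGroup x))
    (hedge : ∀ (x y : V) (e : x ⟶ y),
      2 < ENat.card (𝒢.vertexGroup x ⧸ (𝒢.toOrigin e).range) ∨
      2 < ENat.card (𝒢.vertexGroup y ⧸ (𝒢.toTerminus e).range))
    (x₀ : V) :
    IsICC (𝒢.fundamentalGroup x₀) := by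
  constructor
  · obtain ⟨g, hg⟩ := @exists_ne _ (hvertex x₀).1 (1 : 𝒢.vertexGroup x₀)
    refine ⟨⟨𝒢.of x₀ g, .base g⟩, 1, fun h => hg (of_injective x₀ ?_)⟩
    rw [map_one]
    exact congrArg Subtype.val h
  · rintro ⟨p, hp⟩ hp1
    obtain ⟨n, hn⟩ := IsPath.exists_hasForm hp
    have h := hn.infConj hvertex (branching_or hedge) fun h => hp1 (Subtype.ext h)
    refine Set.Infinite.of_image Subtype.val (h.mono ?_)
    rintro _ ⟨c, hc, rfl⟩
    exact ⟨⟨c, hc⟩ * ⟨p, hp⟩ * ⟨c, hc⟩⁻¹, isConj_iff.2 ⟨⟨c, hc⟩, rfl⟩, rfl⟩
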